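/- Throughout, for nodes $\zeta_0,\dots,\zeta_m$ the divided differences of $f$ are the usual ones, with repeated nodes understood in the confluent (Hermite) sense. For an integer $k\ge 1$ and a sequence $(z_n)_{n\ge 0}$ of complex numbers, let $p_{n,k}$ ($n\ge k$) be the polynomial of degree at most $k$ that interpolates $f$ at $z_n,z_{n-1},\dots,z_{n-k}$, that is, $$p_{n,k}(z)=f(z_n)+\sum_{i=1}^{k}f[z_n,z_{n-1},\dots,z_{n-i}]\prod_{j=0}^{i-1}(z-z_{n-j}).$$ **The orders $s_k$.** For every $k\ge 1$ the equation $s^{k+1}=\sum_{i=0}^k s^i$ has exactly one positive root $s_k$, and $1<s_k<2$ and $s_k<s_{k+1}$ for all $k\ge1$; moreover $2-2^{-k-1}e<s_k<2-2^{-k-1}$ for $k\ge 2$, and $\lim_{k\to\infty}s_k=2$. **Convergence.** Let $k\ge 1$, $r>0$, $\alpha\in\mathbb C$, $B_r=\{z\in\mathbb C:|z-\alpha|\le r\}$, and let $f\in C^{k+1}(B_r)$ (in the sense of complex derivatives) with $f(\alpha)=0$ and $f'(\alpha)\ne 0$. Then there is $\delta>0$ such that for all pairwise distinct $z_0,\dots,z_k\in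 B_r$ with $|z_i-\alpha|<\delta$ for $i=0,\dots,k$, the iteration $$z_{n+1}=z_n-\frac{f(z_n)}{p'_{n,k}(z_n)},\qquad n=k,k+1,\dots,$$ is well defined (all $z_n$ lie in $B_r$ and $p'_{n,k}(z_n)\neq0$ for all $n\ge k$), and $z_n\to\alpha$. Write $\epsilon_n=z_n-\alpha$. Say that $(z_n)$ converges to $\alpha$ with order $p$ if $z_n\to\alpha$ and $|\epsilon_{n+1}|/|\epsilon_n|^p$ tends to a finite nonzero limit. All statements about quotients of errors below refer to iterations that do not reach $\alpha$ in finitely many steps, i.e. $z_n\ne\alpha$ for all $n\ge k$. 1. If $f^{(k+1)}(\alpha)\neq 0$, then $$\lim_{n\to\infty}\frac{\epsilon_{n+1}}{\prod_{i=0}^k\epsilon_{n-i}}=L:=\frac{(-1)^{k+1}}{(k+1)!}\,\frac{f^{(k+1)}(\alpha)}{f'(\alpha)},$$ the sequence $(z_n)$ converges to $\alpha$ with order $s_k$, and $$\lim_{n\to\infty}\frac{|\epsilon_{n+1}|}{|\epsilon_n|^{s_k}}=|L|^{(s_k-1)/k},\qquad \lim_{n\to\infty}\frac{\log|\epsilon_{n+1}/\epsilon_n|}{\log|\epsilon_n/\epsilon_{n-1}|}=s_k.$$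 2. If $f$ coincides on $B_r$ with a polynomial of degree at most $k$, then the iteration is Newton's method, $z_{n+1}=z_n-f(z_n)/f'(z_n)$ for all $n\ge k$, and $$\lim_{n\to\infty}\frac{\epsilon_{n+1}}{\epsilon_n^2}=\frac{f''(\alpha)}{2f'(\alpha)}.$$ Thus $(z_n)$ converges to $\alpha$ with order $2$ if $f''(\alpha)\neq0$, and with some order $p>2$ if $f''(\alpha)=0$. -/

import Mathlib

open Filter Topology

namespace GenSecant

/-- The function `z ↦ f[ζ₀, …, ζ_{m-1}, z]`, obtained by repeatedly taking the difference quotient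
`g ↦ (g z - g ζⱼ) / (z - ζⱼ)` (with value `g' ζⱼ` at `z = ζⱼ`, so that nodes may be repeated). -/
noncomputable def dividedQuot (f : ℂ → ℂ) (ζ : ℕ → ℂ) : ℕ → ℂ → ℂ
  | 0 => f
  | m + 1 => dslope (dividedQuot f ζ m) (ζ m)

/-- The divided difference `f[ζ₀, …, ζ_m]`. -/
noncomputable def dividedDiff (f : ℂ → ℂ) (ζ : ℕ → ℂ) (m : ℕ) : ℂ :=
  dividedQuot f ζ m (ζ m)

/-- The polynomial of degree at most `k` that interpolates `f` at `ζ₀, …, ζ_k`, in Newton's form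
`∑_{i ≤ k} f[ζ₀, …, ζᵢ] ∏_{j < i} (X - ζⱼ)`. -/
noncomputable def interpPoly (f : ℂ → ℂ) (ζ : ℕ → ℂ) (k : ℕ) : Polynomial ℂ :=
  ∑ i ∈ Finset.range (k + 1), Polynomial.C (dividedDiff f ζ i) *
    ∏ j ∈ Finset.range i, (Polynomial.X - Polynomial.C (ζ j))

/-- The error formula of Newton interpolation. -/
theorem sub_eval_interpPoly (f : ℂ → ℂ) (ζ : ℕ → ℂ) (k : ℕ) (w : ℂ) :
    f w - (interpPoly f ζ k).eval w =
      dividedQuot f ζ (k + 1) w * ∏ j ∈ Finset.range (k + 1), (w - ζ j) := by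
  have key : ∀ m : ℕ, dividedQuot f ζ m w - dividedDiff f ζ m =
      (w - ζ m) * dividedQuot f ζ (m + 1) w := fun m => by
    have h := sub_smul_dslope (dividedQuot f ζ m) (ζ m) w
    rw [smul_eq_mul] at h
    exact h.symm
  induction k with
  | zero =>
    have h := key 0
    simp only [interpPoly, zero_add, Finset.sum_range_one, Finset.prod_range_zero, mul_one,
      Polynomial.eval_C, Finset.prod_range_one]
    rw [mul_comm]
    exact h
  | succ k ih =>
    have hs : interpPoly f ζ (k + 1) = interpPoly f ζ k +
        Polynomial.C (dividedDiff f ζ (k + 1)) *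
          ∏ j ∈ Finset.range (k + 1), (Polynomial.X - Polynomial.C (ζ j)) := by
      rw [interpPoly, Finset.sum_range_succ]; rfl
    have h := key (k + 1)
    rw [hs, Polynomial.eval_add, ← sub_sub, ih, Finset.prod_range_succ _ (k + 1)]
    simp only [Polynomial.eval_mul, Polynomial.eval_C, Polynomial.eval_prod,
      Polynomial.eval_sub, Polynomial.eval_X]
    linear_combination (∏ j ∈ Finset.range (k + 1), (w - ζ j)) * h

/-- For pairwise distinct nodes `interpPoly` is the usual Lagrange interpolation polynomial. -/
theorem interpPoly_eq_interpolate (f : ℂ → ℂ) (ζ : ℕ → ℂ) (k : ℕ)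
    (hζ : Set.InjOn ζ (Finset.range (k + 1))) :
    interpPoly f ζ k =
      Lagrange.interpolate (Finset.range (k + 1)) ζ (fun i => f (ζ i)) := by
  refine Lagrange.eq_interpolate_of_eval_eq _ hζ ?_ ?_
  · rw [Finset.card_range]
    refine (Polynomial.degree_sum_le _ _).trans_lt ?_
    rw [Finset.sup_lt_iff (WithBot.bot_lt_coe _)]
    intro i hi
    refine (Polynomial.degree_mul_le_of_le Polynomial.degree_C_le le_rfl).trans_lt ?_
    simp only [Polynomial.degree_prod, Polynomial.degree_X_sub_C, Finset.sum_const,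
      Finset.card_range, zero_add, nsmul_eq_mul, mul_one]
    exact_mod_cast Finset.mem_range.1 hi
  · intro i hi
    have h := sub_eval_interpPoly f ζ k (ζ i)
    rw [Finset.prod_eq_zero hi (sub_self _), mul_zero] at h
    exact (sub_eq_zero.1 h).symm

/-- `p_{n,k}`: the polynomial interpolating `f` at `z_n, z_{n-1}, …, z_{n-k}` (used for `n ≥ k`). -/
noncomputable def stepPoly (f : ℂ → ℂ) (k : ℕ) (z : ℕ → ℂ) (n : ℕ) : Polynomial ℂ :=
  interpPoly f (fun i => z (n - i)) k

/-- `p'_{n,k}(z_n)`. -/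
noncomputable def stepSlope (f : ℂ → ℂ) (k : ℕ) (z : ℕ → ℂ) (n : ℕ) : ℂ :=
  (stepPoly f k z n).derivative.eval (z n)

/-- `z` is generated from `z₀, …, z_k` by the generalized secant recursion. -/
def IsGenSecantSeq (f : ℂ → ℂ) (k : ℕ) (z : ℕ → ℂ) : Prop :=
  ∀ n, k ≤ n → z (n + 1) = z n - f (z n) / stepSlope f k z n

/-- `z` converges to `α` with order exactly `p`: `z_n → α` and `|z_{n+1} - α| / |z_n - α|^p` tends
to a finite nonzero asymptotic error constant. -/
def ConvergesWithOrder (z : ℕ → ℂ) (α : ℂ) (p : ℝ) : Prop :=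
  Tendsto z atTop (𝓝 α) ∧
    ∃ C : ℝ, 0 < C ∧ Tendsto (fun n => ‖z (n + 1) - α‖ / ‖z n - α‖ ^ p) atTop (𝓝 C)

/-- The limit `L = (-1)^{k+1} f^{(k+1)}(α) / ((k+1)! f'(α))`. -/
noncomputable def errConst (f : ℂ → ℂ) (k : ℕ) (α : ℂ) : ℂ :=
  (-1) ^ (k + 1) / ((k + 1).factorial : ℂ) * (iteratedDeriv (k + 1) f α / deriv f α)

end GenSecant

/-! Write g(w) = f(w)/(w - α), with g(α) = f'(α), and D_n for the slope p'_{n,k}(z_n). A step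
multiplies the error by 1 - g(z_n)/D_n, which tends to 0 as the nodes approach α; this gives local
convergence (`exists_contraction_radius`). Differentiating Newton's error formula gives D_n =
f'(z_n) - f[z_n, z_n, …, z_{n-k}] ∏_{1≤j≤k} (z_n - z_{n-j}), while f'(w) = g(w) + (w - α) g'(w).
Hence t_n = ε_{n+1}/∏_{i≤k} ε_{n-i} satisfies t_{n+1} = a_{n+1} t_n + b_{n+1} with a_n → 0 and b_n →
L, which forces t_n → L. The limits of the divided differences come from Cauchy's integral formula
(`tendsto_dividedQuot`).

Taking logarithms, u_n = log|ε_n| obeys a linear recurrence with characteristic polynomial x^{k+1} -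
∑ x^i and a convergent right-hand side. Its root s_k is simple and all other roots lie in the open
unit disc, so dividing out x - s_k leaves a stable recurrence for u_{n+1} - s_k u_n
(`tendsto_sub_order_mul`). Exponentiating gives the order and its constant.

The facts about s_k rest on (x - 1)(x^{k+1} - ∑ x^i) = 1 - (2 - x) x^{k+1}. If f is a polynomial of
degree at most k, the divided difference in D_n vanishes, so the step is Newton's; its order is 2
plus the order of vanishing of g' at α. -/

namespace GenSecant

/-! ### The characteristic equation -/

/-- The characteristic function `x ↦ x ^ (k + 1) - ∑_{i ≤ k} x ^ i`. -/
noncomputable def charFun (k : ℕ) (x : ℝ) : ℝ :=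
  x ^ (k + 1) - ∑ i ∈ Finset.range (k + 1), x ^ i

/-- Scaling by c = y/x > 1 multiplies the leading power by c^(k+1) and every other term by a smaller
factor. So the sign changes only once on the positive axis, which yields uniqueness of the root and
all later comparisons with it. -/
theorem charFun_pos_of_lt {k : ℕ} {x y : ℝ} (hx : 0 < x) (hxy : x < y) (h : 0 ≤ charFun k x) :
    0 < charFun k y := by
  rw [charFun, sub_nonneg] at h
  rw [charFun, sub_pos]
  have hc : 1 < y / x := (one_lt_div hx).2 hxy
  have hy : y = y / x * x := by field_simp
  have key : ∑ i ∈ Finset.range (k + 1), y ^ i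
      < ∑ i ∈ Finset.range (k + 1), (y / x) ^ (k + 1) * x ^ i := by
    refine Finset.sum_lt_sum_of_nonempty (by simp) fun i hi => ?_
    conv_lhs => rw [hy, mul_pow]
    exact mul_lt_mul_of_pos_right (pow_lt_pow_right₀ hc (Finset.mem_range.1 hi)) (by positivity)
  rw [← Finset.mul_sum] at key
  calc _ < _ := key
    _ ≤ (y / x) ^ (k + 1) * x ^ (k + 1) := by gcongr
    _ = y ^ (k + 1) := by rw [← mul_pow, ← hy]

theorem sub_one_mul_charFun (k : ℕ) (x : ℝ) :
    (x - 1) * charFun k x = 1 - (2 - x) * x ^ (k + 1) := by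
  rw [charFun, mul_sub, mul_geom_sum]; ring

/-- At a root for k the right side is -1, so the root for k + 1 lies further right. -/
theorem charFun_succ (k : ℕ) (x : ℝ) : charFun (k + 1) x = x * charFun k x - 1 := by
  rw [charFun, charFun, Finset.sum_range_succ', mul_sub, Finset.mul_sum]
  simp only [pow_succ, pow_zero]
  have : ∀ i, x * x ^ i = x ^ i * x := fun i => mul_comm _ _
  simp only [this]; ring

theorem charFun_one (k : ℕ) : charFun k 1 = -k := by simp [charFun]

theorem charFun_two (k : ℕ) : charFun k 2 = 1 := by
  have := sub_one_mul_charFun k 2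
  norm_num at this; exact this

/-- The endpoint 1 is admitted because it is the root when k = 0; for k ≥ 1 the value -k there
excludes it. -/
theorem exists_charFun_root (k : ℕ) : ∃ x : ℝ, 1 ≤ x ∧ x < 2 ∧ charFun k x = 0 := by
  have hc : ContinuousOn (charFun k) (Set.Icc 1 2) := by unfold charFun; fun_prop
  obtain ⟨x, hx, h⟩ := intermediate_value_Icc (by norm_num : (1 : ℝ) ≤ 2) hc
    (show (0 : ℝ) ∈ Set.Icc _ _ by simp [charFun_one, charFun_two])
  refine ⟨x, hx.1, lt_of_le_of_ne hx.2 ?_, h⟩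
  rintro rfl
  simp [charFun_two] at h

/-- The order `s_k`: the positive root of `x ^ (k + 1) = ∑_{i ≤ k} x ^ i`. -/
noncomputable def order (k : ℕ) : ℝ := (exists_charFun_root k).choose

theorem one_le_order (k : ℕ) : 1 ≤ order k := (exists_charFun_root k).choose_spec.1

theorem order_pos (k : ℕ) : 0 < order k := one_pos.trans_le (one_le_order k)

theorem order_lt_two (k : ℕ) : order k < 2 := (exists_charFun_root k).choose_spec.2.1

theorem charFun_order (k : ℕ) : charFun k (order k) = 0 :=
  (exists_charFun_root k).choose_spec.2.2

theorem one_lt_order {k : ℕ} (hk : 1 ≤ k) : 1 < order k := by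
  refine lt_of_le_of_ne (one_le_order k) fun h => ?_
  have := charFun_order k
  rw [← h, charFun_one] at this
  simp at this; omega

theorem charFun_neg_of_lt {k : ℕ} {x : ℝ} (hx : 0 < x) (h : x < order k) : charFun k x < 0 := by
  by_contra! h0
  exact (charFun_pos_of_lt hx h h0).ne' (charFun_order k)

theorem lt_order_of_charFun_neg {k : ℕ} {x : ℝ} (h : charFun k x < 0) : x < order k := by
  by_contra! h0
  rcases h0.eq_or_lt with h1 | h1
  · rw [← h1, charFun_order] at h; exact h.false
  · exact absurd (charFun_pos_of_lt (order_pos k) h1 (charFun_order k).ge) h.not_gt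

theorem eq_order_iff (k : ℕ) (x : ℝ) :
    (0 < x ∧ x ^ (k + 1) = ∑ i ∈ Finset.range (k + 1), x ^ i) ↔ x = order k := by
  constructor
  · rintro ⟨hx, h⟩
    have h : charFun k x = 0 := sub_eq_zero.2 h
    rcases lt_trichotomy x (order k) with h1 | h1 | h1
    · exact absurd h (charFun_neg_of_lt hx h1).ne
    · exact h1
    · exact absurd h (charFun_pos_of_lt (order_pos k) h1 (charFun_order k).ge).ne'
  · rintro rfl
    exact ⟨order_pos k, sub_eq_zero.1 (charFun_order k)⟩

theorem two_sub_order_mul_pow (k : ℕ) : (2 - order k) * order k ^ (k + 1) = 1 := by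
  have := sub_one_mul_charFun k (order k)
  rw [charFun_order] at this
  linarith

theorem order_lt_order_succ (k : ℕ) : order k < order (k + 1) := by
  apply lt_order_of_charFun_neg
  rw [charFun_succ, charFun_order]; norm_num

theorem order_lt (k : ℕ) : order k < 2 - 1 / 2 ^ (k + 1) := by
  have h := two_sub_order_mul_pow k
  have h1 : order k ^ (k + 1) < 2 ^ (k + 1) :=
    pow_lt_pow_left₀ (order_lt_two k) (order_pos k).le (by simp)
  have h2 : 2 - order k = 1 / order k ^ (k + 1) := by
    rw [eq_div_iff (pow_pos (order_pos k) _).ne', h]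
  have h3 := one_div_lt_one_div_of_lt (pow_pos (order_pos k) (k + 1)) h1
  linarith

/-- The left side is the point where (2 - x) x^(k+1) is maximal, and Bernoulli's inequality shows
that the maximum exceeds 1. The bound serves twice: for the estimate with e and for the simplicity
of the root. -/
theorem two_mul_div_le_order {k : ℕ} (hk : 1 ≤ k) :
    2 * (k + 1) / (k + 2) < order k := by
  apply lt_order_of_charFun_neg
  set x : ℝ := 2 * (k + 1) / (k + 2) with hx
  have hk' : (1 : ℝ) ≤ k := by exact_mod_cast hk
  have hx1 : x = 1 + k / (k + 2) := by rw [hx]; field_simp; ring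
  have hb : 1 + ((k + 1 : ℕ) : ℝ) * (k / (k + 2)) ≤ x ^ (k + 1) := by
    rw [hx1]
    exact one_add_mul_le_pow (by have : (0 : ℝ) ≤ k / (k + 2) := by positivity
                                 linarith) _
  have h2 : 2 - x = 2 / (k + 2) := by rw [hx]; field_simp; ring
  have h3 : 1 < (2 - x) * x ^ (k + 1) := by
    rw [h2]
    refine lt_of_lt_of_le ?_ (mul_le_mul_of_nonneg_left hb (by positivity))
    push_cast
    rw [div_mul_eq_mul_div, lt_div_iff₀ (by positivity)]
    have : 1 + ((k : ℝ) + 1) * (k / (k + 2)) = (k ^ 2 + 2 * k + 2) / (k + 2) := by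
      field_simp; ring
    rw [this, mul_div_assoc', lt_div_iff₀ (by positivity)]
    nlinarith
  have h4 := sub_one_mul_charFun k x
  have hx0 : 0 < x - 1 := by rw [hx1, add_sub_cancel_left]; positivity
  by_contra! h5
  have := mul_nonneg hx0.le h5
  linarith

/-- With s = `order k`, (2 - s) 2^(k+1) = (2/s)^(k+1) = (1 + (2 - s)/s)^(k+1) ≤ exp((k+1)(2 - s)/s),
and the exponent is below 1 exactly when s > 2(k+1)/(k+2). -/
theorem lt_order {k : ℕ} (hk : 1 ≤ k) : 2 - Real.exp 1 / 2 ^ (k + 1) < order k := by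
  have hs := order_pos k
  have h := two_sub_order_mul_pow k
  have hl := two_mul_div_le_order hk
  rw [div_lt_iff₀ (by positivity)] at hl
  have h1 : (2 - order k) * 2 ^ (k + 1) = (1 + (2 - order k) / order k) ^ (k + 1) := by
    have : 1 + (2 - order k) / order k = 2 / order k := by field_simp; ring
    rw [this, div_pow, eq_div_iff (by positivity)]
    linear_combination 2 ^ (k + 1) * h
  have hp : 0 < (2 - order k) / order k := div_pos (by linarith [order_lt_two k]) hs
  have h2 : (1 + (2 - order k) / order k) ^ (k + 1) < Real.exp 1 := by
    calc _ ≤ Real.exp ((2 - order k) / order k) ^ (k + 1) := by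
          gcongr; rw [add_comm]; exact Real.add_one_le_exp _
      _ = Real.exp (((k + 1 : ℕ) : ℝ) * ((2 - order k) / order k)) := (Real.exp_nat_mul _ _).symm
      _ < Real.exp 1 := by
          rw [Real.exp_lt_exp, mul_div_assoc', div_lt_one hs]
          push_cast; nlinarith
  rw [← h1] at h2
  have := (lt_div_iff₀ (by positivity : (0 : ℝ) < 2 ^ (k + 1))).2 h2
  linarith

theorem tendsto_order : Tendsto order atTop (𝓝 2) := by
  have h0 : Tendsto (fun k : ℕ => 2 - Real.exp 1 / 2 ^ (k + 1)) atTop (𝓝 2) := by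
    have h1 : Tendsto (fun k : ℕ => ((1 : ℝ) / 2) ^ (k + 1)) atTop (𝓝 0) :=
      (tendsto_add_atTop_iff_nat 1).2
        (tendsto_pow_atTop_nhds_zero_of_lt_one (by norm_num) (by norm_num))
    have h2 := (h1.const_mul (Real.exp 1)).const_sub 2
    simpa [div_eq_mul_inv] using h2
  refine tendsto_of_tendsto_of_tendsto_of_le_of_le' h0 tendsto_const_nhds ?_ ?_
  · filter_upwards [eventually_ge_atTop 1] with k hk using (lt_order hk).le
  · exact .of_forall fun k => (order_lt_two k).le

/-! ### Linear recurrences with an asymptotically constant right-hand side -/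

/-- Once the perturbation is below (1 - a)ε/2, its accumulated effect stays below ε/2, the fixed
point of x ↦ a x + (1 - a)ε/2, while the initial value decays geometrically. -/
theorem tendsto_zero_of_norm_succ_le {E : Type*} [SeminormedAddCommGroup E] {y : ℕ → E}
    {a : ℝ} (ha0 : 0 ≤ a) (ha : a < 1) {e : ℕ → ℝ} (he : Tendsto e atTop (𝓝 0))
    (h : ∀ᶠ n in atTop, ‖y (n + 1)‖ ≤ a * ‖y n‖ + e n) : Tendsto y atTop (𝓝 0) := by
  rw [Metric.tendsto_atTop]
  intro ε hε
  have h1a : 0 < 1 - a := by linarith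
  have he' : ∀ᶠ n in atTop, e n < (1 - a) * (ε / 2) :=
    he.eventually (gt_mem_nhds (by positivity))
  obtain ⟨N, hN⟩ := eventually_atTop.1 (h.and he')
  have hb : ∀ m, ‖y (N + m)‖ ≤ a ^ m * ‖y N‖ + ε / 2 := by
    intro m
    induction m with
    | zero => simp; positivity
    | succ m ih =>
      obtain ⟨h1, h2⟩ := hN (N + m) (by omega)
      calc ‖y (N + (m + 1))‖ ≤ a * ‖y (N + m)‖ + e (N + m) := h1
        _ ≤ a * (a ^ m * ‖y N‖ + ε / 2) + (1 - a) * (ε / 2) := by gcongr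
        _ = _ := by ring
  have ht : Tendsto (fun m => a ^ m * ‖y N‖) atTop (𝓝 0) := by
    simpa using (tendsto_pow_atTop_nhds_zero_of_lt_one ha0 ha).mul_const ‖y N‖
  obtain ⟨M, hM⟩ := eventually_atTop.1 (ht.eventually (gt_mem_nhds (half_pos hε)))
  refine ⟨N + M, fun n hn => ?_⟩
  obtain ⟨m, rfl⟩ := Nat.exists_eq_add_of_le (show N ≤ n by omega)
  rw [dist_zero_right]
  linarith [hb m, hM m (by omega)]

/-- The shift operator on sequences. -/
def shift : Module.End ℂ (ℕ → ℂ) := LinearMap.funLeft ℂ ℂ Nat.succ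

theorem shift_apply (y : ℕ → ℂ) (n : ℕ) : shift y n = y (n + 1) := rfl

theorem shift_pow_apply (i : ℕ) (y : ℕ → ℂ) (n : ℕ) : (shift ^ i) y n = y (n + i) := by
  induction i generalizing y with
  | zero => rfl
  | succ i ih =>
    rw [pow_succ, Module.End.mul_apply, ih, shift_apply, add_assoc]

/-- Constants are eigenvectors of the shift for the eigenvalue 1. This converts a nonzero limit of
the right-hand side into a limit 0. -/
theorem aeval_shift_const (q : Polynomial ℂ) (c : ℂ) (n : ℕ) :
    Polynomial.aeval shift q (fun _ => c) n = q.eval 1 * c := by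
  induction q using Polynomial.induction_on' with
  | add p q hp hq => simp [hp, hq, add_mul]
  | monomial i a => simp [Polynomial.aeval_monomial, shift_pow_apply, Algebra.algebraMap_eq_smul_one]

/-- Over ℂ the operator splits into linear factors; peeling off one root at a time reduces to
first-order recurrences with multiplier of modulus below 1. -/
theorem tendsto_zero_of_aeval_shift {q : Polynomial ℂ} (hq0 : q ≠ 0)
    (hq : ∀ x, q.IsRoot x → ‖x‖ < 1) {y : ℕ → ℂ}
    (h : Tendsto (Polynomial.aeval shift q y) atTop (𝓝 0)) : Tendsto y atTop (𝓝 0) := by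
  induction hd : q.natDegree generalizing q with
  | zero =>
    obtain ⟨c, rfl⟩ := Polynomial.natDegree_eq_zero.1 hd
    have hc : c ≠ 0 := by rintro rfl; simp at hq0
    have h2 := Tendsto.const_mul c⁻¹ h
    simp only [mul_zero] at h2
    refine h2.congr fun n => ?_
    simp [Algebra.algebraMap_eq_smul_one, hc]
  | succ d ih =>
    obtain ⟨x, hx⟩ := IsAlgClosed.exists_root q
      (by rw [Polynomial.degree_eq_natDegree hq0, hd]; simp; exact_mod_cast d.succ_ne_zero)
    obtain ⟨p, rfl⟩ := Polynomial.dvd_iff_isRoot.2 hx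
    have hp0 : p ≠ 0 := right_ne_zero_of_mul hq0
    refine ih hp0 (fun w hw => hq w ?_) ?_ ?_
    · exact Polynomial.root_mul_left_of_isRoot _ hw
    · refine tendsto_zero_of_norm_succ_le (norm_nonneg x) (hq x hx)
        (tendsto_zero_iff_norm_tendsto_zero.1 h) (.of_forall fun n => ?_)
      have h1 : Polynomial.aeval shift p y (n + 1) = x * Polynomial.aeval shift p y n +
          Polynomial.aeval shift ((Polynomial.X - Polynomial.C x) * p) y n := by
        simp [Algebra.algebraMap_eq_smul_one, shift_apply]
      rw [h1, ← norm_mul]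
      exact norm_add_le _ _
    · rw [Polynomial.natDegree_mul (Polynomial.X_sub_C_ne_zero x) hp0,
        Polynomial.natDegree_X_sub_C] at hd
      omega

/-- The characteristic polynomial `X ^ (k + 1) - ∑_{i ≤ k} X ^ i`. -/
noncomputable def charPoly (k : ℕ) : Polynomial ℂ :=
  Polynomial.X ^ (k + 1) - ∑ i ∈ Finset.range (k + 1), Polynomial.X ^ i

theorem eval_charPoly (k : ℕ) (x : ℂ) :
    (charPoly k).eval x = x ^ (k + 1) - ∑ i ∈ Finset.range (k + 1), x ^ i := by
  simp [charPoly, Polynomial.eval_finsetSum]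

theorem isRoot_charPoly_order (k : ℕ) : (charPoly k).IsRoot (order k : ℂ) := by
  rw [Polynomial.IsRoot, eval_charPoly]
  exact_mod_cast charFun_order k

theorem X_sub_one_mul_charPoly (k : ℕ) :
    (Polynomial.X - 1) * charPoly k = 1 - (2 - Polynomial.X) * Polynomial.X ^ (k + 1) := by
  rw [charPoly, mul_sub, mul_geom_sum]; ring

/-- The triangle inequality in x^(k+1) = ∑ x^i gives ‖x‖ ≤ s_k, and in (2 - x) x^(k+1) = 1 it gives
(‖x‖ - 1) `charFun k ‖x‖` ≥ 0. Hence ‖x‖ is s_k or 1. Either way ‖2 - x‖ = 2 - ‖x‖, so x is real and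
positive, and 1 is not a root. -/
theorem eq_order_of_isRoot_charPoly {k : ℕ} (hk : 1 ≤ k) {x : ℂ} (h : (charPoly k).IsRoot x)
    (hx : 1 ≤ ‖x‖) : x = order k := by
  have h1 : (2 - x) * x ^ (k + 1) = 1 := by
    have := congrArg (Polynomial.eval x) (X_sub_one_mul_charPoly k)
    rw [Polynomial.eval_mul, h.eq_zero] at this
    simp at this
    linear_combination this
  have h2 : ‖2 - x‖ * ‖x‖ ^ (k + 1) = 1 := by rw [← norm_pow, ← norm_mul, h1, norm_one]
  have htri : 2 - ‖x‖ ≤ ‖2 - x‖ := by simpa using norm_sub_norm_le 2 x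
  have hpos : 0 < ‖x‖ := by linarith
  have hle : ‖x‖ ≤ order k := by
    by_contra! hlt
    have := charFun_pos_of_lt (order_pos k) hlt (charFun_order k).ge
    rw [charFun, sub_pos] at this
    rw [Polynomial.IsRoot, eval_charPoly, sub_eq_zero] at h
    rw [← norm_pow, h] at this
    refine this.not_ge ((norm_sum_le _ _).trans (by simp))
  have h3 := sub_one_mul_charFun k ‖x‖
  have h4 : (2 - ‖x‖) * ‖x‖ ^ (k + 1) ≤ 1 := by
    rw [← h2]; gcongr
  -- the real part is determined by the two norms
  have key : ∀ {c : ℝ}, ‖x‖ = c → ‖2 - x‖ = 2 - c → x = c := by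
    intro c hc h2c
    have e1 : x.re ^ 2 + x.im ^ 2 = c ^ 2 := by
      rw [← hc, Complex.sq_norm, Complex.normSq_apply]; ring
    have e2 : (2 - x.re) ^ 2 + x.im ^ 2 = (2 - c) ^ 2 := by
      rw [← h2c, Complex.sq_norm, Complex.normSq_apply]; simp; ring
    have e3 : x.re = c := by linarith
    have e4 : x.im = 0 := by
      rw [e3] at e1
      exact pow_eq_zero_iff two_ne_zero |>.1 (by linarith)
    exact Complex.ext (by simpa using e3) (by simpa using e4)
  rcases hle.eq_or_lt with he | hlt
  · refine key he ?_
    have := two_sub_order_mul_pow k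
    rw [← he, ← h2] at this
    rw [← he]
    exact (mul_right_cancel₀ (by positivity) this).symm
  · exfalso
    have h5 := charFun_neg_of_lt hpos hlt
    have h6 : ‖x‖ = 1 := by nlinarith
    rw [h6, one_pow, mul_one] at h2
    have h7 := key h6 (by rw [h2]; norm_num)
    rw [h7, Polynomial.IsRoot, eval_charPoly] at h
    simp at h
    omega

/-- The deflated polynomial `charPoly k / (X - s_k)` has all its roots in the open unit disc. -/
theorem exists_charPoly_factor {k : ℕ} (hk : 1 ≤ k) :
    ∃ q : Polynomial ℂ, charPoly k = q * (Polynomial.X - Polynomial.C (order k : ℂ)) ∧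
      q.eval 1 * ((order k : ℂ) - 1) = k ∧ ∀ x, q.IsRoot x → ‖x‖ < 1 := by
  obtain ⟨q, hq⟩ := Polynomial.dvd_iff_isRoot.2 (isRoot_charPoly_order k)
  rw [mul_comm] at hq
  refine ⟨q, hq, ?_, fun x hx => ?_⟩
  · have := congrArg (Polynomial.eval 1) hq
    rw [eval_charPoly] at this
    simp at this
    linear_combination this
  · by_contra! h
    have hx' : (charPoly k).IsRoot x := by
      rw [hq, Polynomial.IsRoot, Polynomial.eval_mul, hx.eq_zero, zero_mul]
    obtain rfl := eq_order_of_isRoot_charPoly hk hx' h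
    -- The root s_k would now be double. Differentiating the identity for (X - 1) * `charPoly k`
    -- there would force s_k = 2(k+1)/(k+2), which is strictly too small.
    have h1 := congrArg (fun p => p.derivative.eval (order k : ℂ)) (X_sub_one_mul_charPoly k)
    rw [hq] at h1
    simp [hx.eq_zero] at h1
    have h2 : (order k : ℂ) ^ k * ((k + 2) * order k - 2 * (k + 1)) = 0 := by
      linear_combination -h1
    have h3 : order k ^ k * ((k + 2) * order k - 2 * (k + 1)) = 0 := by exact_mod_cast h2
    have h4 := two_mul_div_le_order hk
    rw [div_lt_iff₀ (by positivity)] at h4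
    rcases mul_eq_zero.1 h3 with h5 | h5
    · exact (pow_pos (order_pos k) k).ne' h5
    · linarith

/-- With S the shift, v = (S - s_k)u satisfies q(S)v → l, where q has all roots in the open disc.
The constant c with q(1)c = l is subtracted from v, and the remainder tends to 0; q(1) = k/(s_k - 1)
explains the factor in the limit. -/
theorem tendsto_sub_order_mul {k : ℕ} (hk : 1 ≤ k) {u : ℕ → ℝ} {l : ℝ}
    (h : Tendsto (fun n => u (n + (k + 1)) - ∑ i ∈ Finset.range (k + 1), u (n + i)) atTop (𝓝 l)) :
    Tendsto (fun n => u (n + 1) - order k * u n) atTop (𝓝 ((order k - 1) / k * l)) := by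
  obtain ⟨q, hq, hq1, hroot⟩ := exists_charPoly_factor hk
  have hk0 : (k : ℂ) ≠ 0 := by exact_mod_cast (by omega : k ≠ 0)
  have hq0 : q ≠ 0 := by rintro rfl; simp at hq1; exact hk0 hq1.symm
  set c : ℂ := (((order k - 1) / k * l : ℝ) : ℂ) with hc
  have hqc : q.eval 1 * c = l := by
    rw [hc]; push_cast
    field_simp
    linear_combination (l : ℂ) * hq1
  set U : ℕ → ℂ := fun n => (u n : ℂ)
  have hU : Polynomial.aeval shift (Polynomial.X - Polynomial.C (order k : ℂ)) U =
      fun n => ((u (n + 1) - order k * u n : ℝ) : ℂ) := by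
    ext n
    simp [Algebra.algebraMap_eq_smul_one, shift_apply, U]
  have hp : Polynomial.aeval shift (charPoly k) U = fun n =>
      ((u (n + (k + 1)) - ∑ i ∈ Finset.range (k + 1), u (n + i) : ℝ) : ℂ) := by
    ext n
    simp [charPoly, shift_pow_apply, U, LinearMap.sum_apply]
  have h1 : Tendsto (fun n => ((u (n + 1) - order k * u n : ℝ) : ℂ) - c) atTop (𝓝 0) := by
    refine tendsto_zero_of_aeval_shift hq0 hroot ?_
    have e : Polynomial.aeval shift q (fun n => ((u (n + 1) - order k * u n : ℝ) : ℂ) - c) =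
        fun n => ((u (n + (k + 1)) - ∑ i ∈ Finset.range (k + 1), u (n + i) : ℝ) : ℂ) - l := by
      change Polynomial.aeval shift q
        ((fun n => ((u (n + 1) - order k * u n : ℝ) : ℂ)) - fun _ => c) = _
      rw [map_sub, ← hU, ← Module.End.mul_apply, ← map_mul, ← hq, hp]
      ext n
      rw [Pi.sub_apply, aeval_shift_const, hqc]
    rw [e, ← sub_self (l : ℂ)]
    exact ((Complex.continuous_ofReal.tendsto l).comp h).sub_const _
  have h2 := (Complex.continuous_re.tendsto _).comp h1
  have h3 := h2.add_const ((order k - 1) / k * l)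
  simp only [Complex.zero_re, zero_add] at h3
  refine h3.congr fun n => ?_
  simp only [Function.comp, hc, ← Complex.ofReal_sub, Complex.ofReal_re]
  ring

/-! ### Asymptotics of errors -/

section Errors

variable {k : ℕ} {ε : ℕ → ℂ} {L : ℂ}

/-- The logarithm turns the product of errors into the sum of the linear recurrence. -/
theorem tendsto_log_sub_order_mul (hk : 1 ≤ k) (hL : L ≠ 0) (hne : ∀ᶠ n in atTop, ε n ≠ 0)
    (h : Tendsto (fun n => ε (n + 1) / ∏ i ∈ Finset.range (k + 1), ε (n - i)) atTop (𝓝 L)) :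
    Tendsto (fun n => Real.log ‖ε (n + 1)‖ - order k * Real.log ‖ε n‖) atTop
      (𝓝 ((order k - 1) / k * Real.log ‖L‖)) := by
  refine tendsto_sub_order_mul hk (u := fun n => Real.log ‖ε n‖) ?_
  -- Shifting by k makes every subtraction n + k - i genuine and puts the recurrence in forward
  -- form.
  have h1 := (h.norm.log (norm_ne_zero_iff.2 hL)).comp (tendsto_add_atTop_nat k)
  refine h1.congr' ?_
  obtain ⟨N, hN⟩ := eventually_atTop.1 hne
  filter_upwards [eventually_ge_atTop N] with n hn
  have hn0 : ∀ i, ‖ε (n + i)‖ ≠ 0 := fun i => norm_ne_zero_iff.2 (hN _ (by omega))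
  have h2 : ∏ i ∈ Finset.range (k + 1), ε (n + k - i) =
      ∏ i ∈ Finset.range (k + 1), ε (n + i) := by
    rw [← Finset.prod_range_reflect]
    refine Finset.prod_congr rfl fun i hi => ?_
    rw [Finset.mem_range] at hi
    congr 1; omega
  simp only [Function.comp]
  rw [h2, norm_div, norm_prod, add_assoc, Real.log_div (hn0 _)
    (Finset.prod_ne_zero_iff.2 fun i _ => hn0 i), Real.log_prod fun i _ => hn0 i]

theorem tendsto_norm_div_rpow_order (hk : 1 ≤ k) (hL : L ≠ 0) (hne : ∀ᶠ n in atTop, ε n ≠ 0)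
    (h : Tendsto (fun n => ε (n + 1) / ∏ i ∈ Finset.range (k + 1), ε (n - i)) atTop (𝓝 L)) :
    Tendsto (fun n => ‖ε (n + 1)‖ / ‖ε n‖ ^ order k) atTop
      (𝓝 (‖L‖ ^ ((order k - 1) / (k : ℝ)))) := by
  have h1 := (Real.continuous_exp.tendsto _).comp (tendsto_log_sub_order_mul hk hL hne h)
  rw [mul_comm, ← Real.rpow_def_of_pos (norm_pos_iff.2 hL)] at h1
  refine h1.congr' ?_
  filter_upwards [hne, (tendsto_add_atTop_nat 1).eventually hne] with n hn hn1
  have hp := norm_pos_iff.2 hn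
  have hp1 := norm_pos_iff.2 hn1
  simp only [Function.comp]
  rw [Real.exp_sub, Real.exp_log hp1, mul_comm, Real.rpow_def_of_pos hp]

/-- Since u n = log‖ε n‖ tends to -∞ and y n = u (n + 1) - s_k u n converges, y is negligible
against u, and the increments of u grow by the factor s_k asymptotically. -/
theorem tendsto_log_ratio (hk : 1 ≤ k) (hL : L ≠ 0) (hne : ∀ᶠ n in atTop, ε n ≠ 0)
    (h0 : Tendsto ε atTop (𝓝 0))
    (h : Tendsto (fun n => ε (n + 1) / ∏ i ∈ Finset.range (k + 1), ε (n - i)) atTop (𝓝 L)) :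
    Tendsto (fun n => Real.log ‖ε (n + 1) / ε n‖ / Real.log ‖ε n / ε (n - 1)‖) atTop
      (𝓝 (order k)) := by
  rw [← tendsto_add_atTop_iff_nat 1]
  set u : ℕ → ℝ := fun n => Real.log ‖ε n‖ with hu
  set y : ℕ → ℝ := fun n => u (n + 1) - order k * u n with hy
  set c : ℝ := (order k - 1) / k * Real.log ‖L‖
  have hyt : Tendsto y atTop (𝓝 c) := tendsto_log_sub_order_mul hk hL hne h
  have hut : Tendsto u atTop atBot := by
    refine Real.tendsto_log_nhdsNE_zero.comp (tendsto_nhdsWithin_iff.2 ⟨?_, ?_⟩)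
    · simpa using h0.norm
    · filter_upwards [hne] with n hn using norm_ne_zero_iff.2 hn
  have hinv : Tendsto (fun n => (u n)⁻¹) atTop (𝓝 0) := tendsto_inv_atBot_zero.comp hut
  have hs := one_lt_order hk
  -- both increments are compared with `u n`
  have h1 : Tendsto (fun n => (order k - 1) + y n * (u n)⁻¹) atTop (𝓝 (order k - 1)) := by
    simpa using (hyt.mul hinv).const_add (order k - 1)
  have h2 : Tendsto (fun n => (order k - 1) * order k +
      (y (n + 1) + (order k - 1) * y n) * (u n)⁻¹) atTop (𝓝 ((order k - 1) * order k)) := by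
    simpa using (((hyt.comp (tendsto_add_atTop_nat 1)).add
      (hyt.const_mul (order k - 1))).mul hinv).const_add ((order k - 1) * order k)
  have h3 := h2.div h1 (by linarith)
  rw [mul_div_cancel_left₀ _ (by linarith : order k - 1 ≠ 0)] at h3
  refine h3.congr' ?_
  obtain ⟨N, hN⟩ := eventually_atTop.1 hne
  filter_upwards [eventually_ge_atTop N, hut.eventually_lt_atBot 0] with n hn hun
  have hl : ∀ m, N ≤ m → Real.log ‖ε (m + 1) / ε m‖ = u (m + 1) - u m := fun m hm => by
    rw [norm_div, Real.log_div (norm_ne_zero_iff.2 (hN _ (by omega)))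
      (norm_ne_zero_iff.2 (hN _ hm))]
  rw [Nat.add_sub_cancel, hl _ (by omega), hl _ hn, Pi.div_apply]
  have e1 : u (n + 1) - u n = u n * ((order k - 1) + y n * (u n)⁻¹) := by
    rw [mul_add, mul_left_comm, mul_inv_cancel₀ hun.ne, hy]; ring
  have e2 : u (n + 1 + 1) - u (n + 1) = u n * ((order k - 1) * order k +
      (y (n + 1) + (order k - 1) * y n) * (u n)⁻¹) := by
    have := mul_inv_cancel₀ hun.ne
    simp only [hy] at this ⊢
    linear_combination (-(u (n + 1 + 1) - order k * u (n + 1)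
      + (order k - 1) * (u (n + 1) - order k * u n))) * this
  rw [e1, e2, mul_div_mul_left _ _ hun.ne]

end Errors


/-! ### Divided differences of holomorphic functions -/

section Cauchy

variable {f : ℂ → ℂ} {α : ℂ} {r : ℝ}

theorem differentiableOn_dividedQuot {U : Set ℂ} (hU : IsOpen U) (hf : DifferentiableOn ℂ f U)
    {ζ : ℕ → ℂ} {m : ℕ} (hζ : ∀ j < m, ζ j ∈ U) : DifferentiableOn ℂ (dividedQuot f ζ m) U := by
  induction m with
  | zero => exact hf
  | succ m ih =>
    exact (Complex.differentiableOn_dslope (hU.mem_nhds (hζ m (by omega)))).2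
      (ih fun j hj => hζ j (by omega))

theorem sub_ne_zero_of_mem_sphere_of_mem_ball {w a : ℂ} (hw : w ∈ Metric.sphere α r)
    (ha : a ∈ Metric.ball α r) : w - a ≠ 0 := by
  rw [sub_ne_zero]
  rintro rfl
  exact (Metric.mem_ball.1 ha).ne (Metric.mem_sphere.1 hw)

/-- The Cauchy integral formula for divided differences. -/
theorem dividedQuot_eq_circleIntegral (hr : 0 < r) (hf : DiffContOnCl ℂ f (Metric.ball α r))
    {ζ : ℕ → ℂ} {m : ℕ} (hζ : ∀ j < m, ζ j ∈ Metric.ball α r) {a : ℂ}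
    (ha : a ∈ Metric.ball α r) :
    dividedQuot f ζ m a = (2 * Real.pi * Complex.I)⁻¹ *
      ∮ w in C(α, r), (w - a)⁻¹ * ((∏ j ∈ Finset.range m, (w - ζ j)⁻¹) * f w) := by
  have hI : (2 * Real.pi * Complex.I : ℂ) ≠ 0 := Complex.two_pi_I_ne_zero
  have hfs : ContinuousOn f (Metric.sphere α r) :=
    hf.continuousOn.mono (by
      rw [closure_ball _ hr.ne']; exact Metric.sphere_subset_closedBall)
  have hcont : ∀ m, (∀ j < m, ζ j ∈ Metric.ball α r) → ContinuousOn
      (fun w => (∏ j ∈ Finset.range m, (w - ζ j)⁻¹) * f w) (Metric.sphere α r) := by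
    intro m hm
    refine ContinuousOn.mul (continuousOn_finsetProd _ fun j hj => ?_) hfs
    exact (continuousOn_id.sub continuousOn_const).inv₀ fun w hw =>
      sub_ne_zero_of_mem_sphere_of_mem_ball hw (hm j (Finset.mem_range.1 hj))
  have hcont' : ∀ m, (∀ j < m, ζ j ∈ Metric.ball α r) → ∀ a ∈ Metric.ball α r,
      CircleIntegrable (fun w => (w - a)⁻¹ * ((∏ j ∈ Finset.range m, (w - ζ j)⁻¹) * f w)) α r := by
    intro m hm a ha
    refine ContinuousOn.circleIntegrable hr.le (ContinuousOn.mul ?_ (hcont m hm))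
    exact (continuousOn_id.sub continuousOn_const).inv₀ fun w hw =>
      sub_ne_zero_of_mem_sphere_of_mem_ball hw ha
  induction m generalizing a with
  | zero =>
    have := hf.circleIntegral_sub_inv_smul ha
    simp only [smul_eq_mul] at this
    simp only [Finset.range_zero, Finset.prod_empty, one_mul, this, dividedQuot]
    rw [inv_mul_cancel_left₀ hI]
  | succ m ih =>
    have hζ' : ∀ j < m, ζ j ∈ Metric.ball α r := fun j hj => hζ j (by omega)
    have hζm := hζ m (by omega)
    set G : ℂ → ℂ := fun a => (2 * Real.pi * Complex.I)⁻¹ *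
      ∮ w in C(α, r), (w - a)⁻¹ * ((∏ j ∈ Finset.range (m + 1), (w - ζ j)⁻¹) * f w)
    -- Away from the new node the difference quotient of the two Cauchy kernels is their product. At
    -- the node itself the formula follows by continuity of both sides, so confluent nodes need no
    -- separate computation.
    have hne : ∀ a ∈ Metric.ball α r, a ≠ ζ m → dividedQuot f ζ (m + 1) a = G a := by
      intro a ha hane
      have hane' : a - ζ m ≠ 0 := sub_ne_zero.2 hane
      change dslope (dividedQuot f ζ m) (ζ m) a = _
      rw [dslope_of_ne _ hane, slope_def_field, ih hζ' ha, ih hζ' hζm, ← mul_sub,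
        ← circleIntegral.integral_sub (hcont' m hζ' a ha) (hcont' m hζ' _ hζm), mul_div_assoc,
        div_eq_inv_mul, ← circleIntegral.integral_const_mul]
      congr 1
      refine circleIntegral.integral_congr hr.le fun w hw => ?_
      have h1 := sub_ne_zero_of_mem_sphere_of_mem_ball hw ha
      have h2 := sub_ne_zero_of_mem_sphere_of_mem_ball hw hζm
      simp only [Finset.prod_range_succ]
      field_simp
      ring
    by_cases hane : a = ζ m
    · rw [hane]
      have hG : ContinuousAt G (ζ m) := by
        have := hasFPowerSeriesOn_cauchy_integral (c := α) (R := .mk r hr.le)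
          ((hcont (m + 1) hζ).circleIntegrable hr.le) hr
        have := this.continuousOn.continuousAt (x := ζ m)
          (Metric.isOpen_eball.mem_nhds (by rw [Metric.eball_coe]; exact hζm))
        exact this
      have hD : ContinuousAt (dividedQuot f ζ (m + 1)) (ζ m) :=
        ((differentiableOn_dividedQuot Metric.isOpen_ball hf.differentiableOn hζ).differentiableAt
          (Metric.isOpen_ball.mem_nhds hζm)).continuousAt
      refine tendsto_nhds_unique (hD.tendsto.mono_left nhdsWithin_le_nhds)
        ((hG.tendsto.mono_left nhdsWithin_le_nhds).congr' ?_ : Tendsto _ (𝓝[≠] ζ m) _)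
      filter_upwards [self_mem_nhdsWithin,
        mem_nhdsWithin_of_mem_nhds (Metric.isOpen_ball.mem_nhds hζm)] with b hb hb'
      exact (hne b hb' hb).symm
    · exact hne a ha hane

/-- All nodes merge at α inside Cauchy's formula; dominated convergence leaves the integral for the
m-th derivative. Coinciding nodes are allowed. -/
theorem tendsto_dividedQuot (hr : 0 < r) (hf : DiffContOnCl ℂ f (Metric.ball α r))
    {ζ : ℕ → ℕ → ℂ} {a : ℕ → ℂ} (m : ℕ) (hζ : ∀ j < m, Tendsto (fun n => ζ n j) atTop (𝓝 α))
    (ha : Tendsto a atTop (𝓝 α)) :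
    Tendsto (fun n => dividedQuot f (ζ n) m (a n)) atTop
      (𝓝 (iteratedDeriv m f α / (m.factorial : ℂ))) := by
  have hI : (2 * Real.pi * Complex.I : ℂ) ≠ 0 := Complex.two_pi_I_ne_zero
  have hfs : ContinuousOn f (Metric.sphere α r) :=
    hf.continuousOn.mono (by
      rw [closure_ball _ hr.ne']; exact Metric.sphere_subset_closedBall)
  have hval : iteratedDeriv m f α / (m.factorial : ℂ) = (2 * Real.pi * Complex.I)⁻¹ *
      ∮ w in C(α, r), (w - α)⁻¹ * ((∏ j ∈ Finset.range m, (w - α)⁻¹) * f w) := by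
    have h1 := hf.circleIntegral_one_div_sub_center_pow_smul hr m
    have h2 : (∮ w in C(α, r), (w - α)⁻¹ * ((∏ j ∈ Finset.range m, (w - α)⁻¹) * f w)) =
        ∮ w in C(α, r), (1 / (w - α) ^ (m + 1)) • f w := by
      congr 1; ext w
      simp only [Finset.prod_const, Finset.card_range, smul_eq_mul]
      rw [one_div, ← inv_pow, pow_succ']; ring
    rw [h2, h1, smul_eq_mul]
    field_simp
  -- Nodes within r/2 of the centre keep distance at least r/2 from the circle, which provides the
  -- dominating function.
  have hnear : ∀ᶠ n in atTop, (∀ j ∈ Finset.range m, ζ n j ∈ Metric.ball α (r / 2)) ∧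
      a n ∈ Metric.ball α (r / 2) := by
    have hb := Metric.ball_mem_nhds α (half_pos hr)
    refine Eventually.and ?_ (ha hb)
    rw [eventually_all_finset]
    intro j hj
    exact hζ j (Finset.mem_range.1 hj) hb
  have hsub : Metric.ball α (r / 2) ⊆ Metric.ball α r := Metric.ball_subset_ball (by linarith)
  have hinv : ∀ {w b : ℂ}, w ∈ Metric.sphere α r → b ∈ Metric.ball α (r / 2) →
      ‖(w - b)⁻¹‖ ≤ (r / 2)⁻¹ := by
    intro w b hw hb
    rw [norm_inv]
    refine inv_anti₀ (by linarith) ?_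
    rw [Metric.mem_sphere] at hw
    rw [Metric.mem_ball] at hb
    rw [← dist_eq_norm]
    linarith [dist_triangle w b α]
  have hkey : Tendsto (fun n => ∮ w in C(α, r), (w - a n)⁻¹ *
      ((∏ j ∈ Finset.range m, (w - ζ n j)⁻¹) * f w)) atTop
      (𝓝 (∮ w in C(α, r), (w - α)⁻¹ * ((∏ j ∈ Finset.range m, (w - α)⁻¹) * f w))) := by
    have hsph : ∀ θ, circleMap α r θ ∈ Metric.sphere α r := circleMap_mem_sphere α hr.le
    have hfc : Continuous fun θ => f (circleMap α r θ) :=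
      hfs.comp_continuous (continuous_circleMap α r) hsph
    refine intervalIntegral.tendsto_integral_filter_of_dominated_convergence
      (fun θ => r * ((r / 2)⁻¹ * ((r / 2)⁻¹ ^ m * ‖f (circleMap α r θ)‖))) ?_ ?_ ?_ ?_
    · filter_upwards [hnear] with n hn
      refine Continuous.aestronglyMeasurable ?_
      simp only [deriv_circleMap]
      refine ((continuous_circleMap 0 r).mul continuous_const).smul (Continuous.mul ?_
        ((continuous_finsetProd _ fun j hj => ?_).mul hfc))
      · exact ((continuous_circleMap α r).sub continuous_const).inv₀ fun θ =>
          sub_ne_zero_of_mem_sphere_of_mem_ball (hsph θ) (hsub hn.2)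
      · exact ((continuous_circleMap α r).sub continuous_const).inv₀ fun θ =>
          sub_ne_zero_of_mem_sphere_of_mem_ball (hsph θ) (hsub (hn.1 j hj))
    · filter_upwards [hnear] with n hn
      refine .of_forall fun θ _ => ?_
      have h1 : ‖deriv (circleMap α r) θ‖ = r := by simp [deriv_circleMap, abs_of_pos hr]
      rw [norm_smul, h1, norm_mul, norm_mul, norm_prod]
      gcongr
      · exact hinv (hsph θ) hn.2
      · refine (Finset.prod_le_prod (fun _ _ => norm_nonneg _)
          fun j hj => hinv (hsph θ) (hn.1 j hj)).trans_eq
          (by rw [Finset.prod_const, Finset.card_range])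
    · exact Continuous.intervalIntegrable (continuous_const.mul (continuous_const.mul
        (continuous_const.mul hfc.norm))) _ _
    · refine .of_forall fun θ _ => ?_
      have hα := sub_ne_zero_of_mem_sphere_of_mem_ball (hsph θ) (Metric.mem_ball_self hr)
      refine Tendsto.const_smul (Tendsto.mul ((tendsto_const_nhds.sub ha).inv₀ hα)
        (Tendsto.mul_const _ (tendsto_finsetProd _ fun j hj => ?_))) _
      exact (tendsto_const_nhds.sub (hζ j (Finset.mem_range.1 hj))).inv₀ hα
  rw [hval]
  refine (hkey.const_mul _).congr' ?_
  filter_upwards [hnear] with n hn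
  rw [dividedQuot_eq_circleIntegral hr hf (fun j hj => hsub (hn.1 j (Finset.mem_range.2 hj)))
    (hsub hn.2)]

/-- Both sides are the confluent divided difference f[α, α, α], obtained from constant node
sequences. -/
theorem deriv_dslope_self (hr : 0 < r) (hf : DiffContOnCl ℂ f (Metric.ball α r)) :
    deriv (dslope f α) α = iteratedDeriv 2 f α / 2 := by
  have h := tendsto_dividedQuot hr hf (ζ := fun _ _ => α) 2
    (fun _ _ => tendsto_const_nhds) (a := fun _ => α) tendsto_const_nhds
  have h2 := tendsto_nhds_unique h tendsto_const_nhds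
  simp only [dividedQuot, dslope_same] at h2
  rw [← h2]; norm_num

/-- The divided differences of order `k + 1` of a polynomial of degree at most `k` vanish. -/
theorem dividedQuot_eq_zero_of_polynomial {U : Set ℂ} (hU : IsOpen U) {P : Polynomial ℂ} {k : ℕ}
    (hP : P.natDegree ≤ k) (hf : ∀ w ∈ U, f w = P.eval w) {ζ : ℕ → ℂ}
    (hζ : ∀ j < k + 1, ζ j ∈ U) {w : ℂ} (hw : w ∈ U) : dividedQuot f ζ (k + 1) w = 0 := by
  -- Each quotient divides exactly by X - ζ m and so lowers the degree bound by one; at m = k + 1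
  -- only the zero polynomial remains.
  have key : ∀ m ≤ k + 1, ∃ R ∈ Polynomial.degreeLT ℂ (k + 1 - m),
      ∀ w ∈ U, dividedQuot f ζ m w = R.eval w := by
    intro m hm
    induction m with
    | zero =>
      exact ⟨P, Polynomial.mem_degreeLT.2 (lt_of_le_of_lt Polynomial.degree_le_natDegree
        (by exact_mod_cast Nat.lt_succ_of_le hP)), hf⟩
    | succ m ih =>
      obtain ⟨R, hR, hRe⟩ := ih (by omega)
      have hroot : (R - Polynomial.C (R.eval (ζ m))).IsRoot (ζ m) := by simp
      obtain ⟨S, hS⟩ := Polynomial.dvd_iff_isRoot.2 hroot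
      have hSe : ∀ w, R.eval w - R.eval (ζ m) = (w - ζ m) * S.eval w := fun w => by
        simpa using congrArg (Polynomial.eval w) hS
      refine ⟨S, ?_, fun w hw => ?_⟩
      · rw [Polynomial.mem_degreeLT] at hR ⊢
        have hlt : (R - Polynomial.C (R.eval (ζ m))).degree < ((k + 1 - m : ℕ) : WithBot ℕ) :=
          (Polynomial.degree_sub_le _ _).trans_lt (max_lt hR
            (Polynomial.degree_C_le.trans_lt (by exact_mod_cast (by omega : 0 < k + 1 - m))))
        by_cases hS0 : S = 0
        · simp [hS0]
        rw [hS, Polynomial.degree_mul, Polynomial.degree_X_sub_C,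
          Polynomial.degree_eq_natDegree hS0] at hlt
        rw [Polynomial.degree_eq_natDegree hS0]
        have h1 : 1 + S.natDegree < k + 1 - m := by exact_mod_cast hlt
        exact_mod_cast (by omega : S.natDegree < k + 1 - (m + 1))
      · have hζm := hζ m (by omega)
        change dslope (dividedQuot f ζ m) (ζ m) w = _
        by_cases hwζ : w = ζ m
        · rw [hwζ, dslope_same]
          have h1 : dividedQuot f ζ m =ᶠ[𝓝 (ζ m)] fun w => R.eval (ζ m) + (w - ζ m) * S.eval w := by
            filter_upwards [hU.mem_nhds hζm] with b hb
            rw [hRe b hb, ← hSe b]; ring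
          rw [h1.deriv_eq]
          have h2 := (((hasDerivAt_id (ζ m)).sub_const (ζ m)).mul
            (S.hasDerivAt (ζ m))).const_add (R.eval (ζ m))
          simpa using h2.deriv
        · rw [dslope_of_ne _ hwζ, slope_def_field, hRe w hw, hRe _ hζm, hSe w,
            mul_div_cancel_left₀ _ (sub_ne_zero.2 hwζ)]
  obtain ⟨R, hR, hRe⟩ := key (k + 1) le_rfl
  rw [hRe w hw]
  rw [Polynomial.mem_degreeLT, Polynomial.degree_lt_iff_coeff_zero] at hR
  have : R = 0 := by ext i; simpa using hR i (by simp)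
  simp [this]

/-- In the error formula the factor w - ζ 0 vanishes at ζ 0, so only the term that differentiates
this factor survives. -/
theorem derivative_interpPoly_eval {ζ : ℕ → ℂ} {k : ℕ} (hf : DifferentiableAt ℂ f (ζ 0))
    (hQ : DifferentiableAt ℂ (dividedQuot f ζ (k + 1)) (ζ 0)) :
    (interpPoly f ζ k).derivative.eval (ζ 0) = deriv f (ζ 0) -
      dividedQuot f ζ (k + 1) (ζ 0) * ∏ j ∈ Finset.range k, (ζ 0 - ζ (j + 1)) := by
  have h1 : (fun w => (interpPoly f ζ k).eval w) = fun w => f w -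
      dividedQuot f ζ (k + 1) w * (∏ j ∈ Finset.range k, (w - ζ (j + 1))) * (w - ζ 0) := by
    ext w
    have := sub_eval_interpPoly f ζ k w
    rw [Finset.prod_range_succ'] at this
    linear_combination -this
  have hW : DifferentiableAt ℂ (fun w => ∏ j ∈ Finset.range k, (w - ζ (j + 1))) (ζ 0) := by
    fun_prop
  have h2 := hf.hasDerivAt.sub ((hQ.mul hW).hasDerivAt.mul ((hasDerivAt_id (ζ 0)).sub_const (ζ 0)))
  rw [← Polynomial.deriv, h1]
  refine h2.deriv.trans ?_
  simp

end Cauchy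

/-! ### The generalized secant iteration -/

section Iteration

variable {f : ℂ → ℂ} {α : ℂ} {r : ℝ} {k : ℕ} {z : ℕ → ℂ}

theorem eq_sub_mul_dslope (hα : f α = 0) (w : ℂ) : f w = (w - α) * dslope f α w := by
  have := sub_smul_dslope f α w
  rw [hα, sub_zero, smul_eq_mul] at this
  exact this.symm

theorem differentiableOn_dslope_ball (hr : 0 < r) (hf : DiffContOnCl ℂ f (Metric.ball α r)) :
    DifferentiableOn ℂ (dslope f α) (Metric.ball α r) :=
  (Complex.differentiableOn_dslope (Metric.ball_mem_nhds α hr)).2 hf.differentiableOn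

theorem analyticAt_dslope (hr : 0 < r) (hf : DiffContOnCl ℂ f (Metric.ball α r)) :
    AnalyticAt ℂ (dslope f α) α :=
  (differentiableOn_dslope_ball hr hf).analyticAt (Metric.ball_mem_nhds α hr)

theorem tendsto_deriv (hr : 0 < r) (hf : DiffContOnCl ℂ f (Metric.ball α r)) :
    Tendsto (deriv f) (𝓝 α) (𝓝 (deriv f α)) :=
  (hf.differentiableOn.analyticAt (Metric.ball_mem_nhds α hr)).deriv.continuousAt

theorem deriv_eq_dslope_add (hr : 0 < r) (hf : DiffContOnCl ℂ f (Metric.ball α r))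
    (hα : f α = 0) {w : ℂ} (hw : w ∈ Metric.ball α r) :
    deriv f w = dslope f α w + (w - α) * deriv (dslope f α) w := by
  have h1 : f = fun w => (w - α) * dslope f α w := funext (eq_sub_mul_dslope hα)
  have h2 := ((hasDerivAt_id w).sub_const α).mul ((differentiableOn_dslope_ball hr hf).differentiableAt
    (Metric.isOpen_ball.mem_nhds hw)).hasDerivAt
  conv_lhs => rw [h1]
  refine h2.deriv.trans ?_
  simp

theorem derivative_interpPoly_eval_of_mem_ball (hf : DiffContOnCl ℂ f (Metric.ball α r))
    {ζ : ℕ → ℂ} (hζ : ∀ j ≤ k, ζ j ∈ Metric.ball α r) :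
    (interpPoly f ζ k).derivative.eval (ζ 0) = deriv f (ζ 0) -
      dividedQuot f ζ (k + 1) (ζ 0) * ∏ j ∈ Finset.range k, (ζ 0 - ζ (j + 1)) := by
  have h0 := Metric.isOpen_ball.mem_nhds (hζ 0 (Nat.zero_le _))
  exact derivative_interpPoly_eval (hf.differentiableOn.differentiableAt h0)
    ((differentiableOn_dividedQuot Metric.isOpen_ball hf.differentiableOn
      fun j hj => hζ j (Nat.le_of_lt_succ hj)).differentiableAt h0)

/-- The correction to f' contains k ≥ 1 node differences, all tending to 0, times a convergent
divided difference. -/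
theorem tendsto_derivative_interpPoly (hk : 1 ≤ k) (hr : 0 < r)
    (hf : DiffContOnCl ℂ f (Metric.ball α r)) {ζ : ℕ → ℕ → ℂ}
    (hζ : ∀ j ≤ k, Tendsto (fun n => ζ n j) atTop (𝓝 α)) :
    Tendsto (fun n => (interpPoly f (ζ n) k).derivative.eval (ζ n 0)) atTop (𝓝 (deriv f α)) := by
  have h0 := hζ 0 (Nat.zero_le _)
  have hQ := tendsto_dividedQuot hr hf (k + 1) (fun j hj => hζ j (Nat.le_of_lt_succ hj)) h0
  have hW : Tendsto (fun n => ∏ j ∈ Finset.range k, (ζ n 0 - ζ n (j + 1))) atTop (𝓝 0) := by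
    have := tendsto_finsetProd (Finset.range k) fun j hj =>
      h0.sub (hζ (j + 1) (Finset.mem_range.1 hj))
    simpa [zero_pow (by omega : k ≠ 0)] using this
  have h1 := ((tendsto_deriv hr hf).comp h0).sub (hQ.mul hW)
  rw [mul_zero, sub_zero] at h1
  refine h1.congr' ?_
  have hb : ∀ᶠ n in atTop, ∀ j ∈ Finset.range (k + 1), ζ n j ∈ Metric.ball α r := by
    rw [eventually_all_finset]
    exact fun j hj => hζ j (Nat.le_of_lt_succ (Finset.mem_range.1 hj)) (Metric.ball_mem_nhds α hr)
  filter_upwards [hb] with n hn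
  exact (derivative_interpPoly_eval_of_mem_ball hf
    fun j hj => hn j (Finset.mem_range.2 (Nat.lt_succ_of_le hj))).symm

/-- The multiplier of the error tends to 0 when w → α and D → f'(α), because `dslope f α` has the
value f'(α) at α. -/
theorem step_sub_eq (hα : f α = 0) {w D : ℂ} :
    w - f w / D - α = (1 - dslope f α w / D) * (w - α) := by
  rw [eq_sub_mul_dslope hα w]; ring

/-- If no radius worked, there would be bad node tuples within 1/(n + 1) of α. Along them the slope
tends to f'(α) ≠ 0 and the error multiplier to 0, a contradiction. -/
theorem exists_contraction_radius (hk : 1 ≤ k) (hr : 0 < r)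
    (hf : DiffContOnCl ℂ f (Metric.ball α r)) (hα : f α = 0) (hd : deriv f α ≠ 0) :
    ∃ δ : ℝ, 0 < δ ∧ δ ≤ r ∧ ∀ ζ : ℕ → ℂ, (∀ j ≤ k, ‖ζ j - α‖ < δ) →
      (interpPoly f ζ k).derivative.eval (ζ 0) ≠ 0 ∧
      ‖ζ 0 - f (ζ 0) / (interpPoly f ζ k).derivative.eval (ζ 0) - α‖ ≤ 1 / 2 * ‖ζ 0 - α‖ := by
  by_contra! hcon
  have hδ : ∀ n : ℕ, 0 < min r (1 / ((n : ℝ) + 1)) := fun n => lt_min hr (by positivity)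
  choose ζ hζ hbad using fun n : ℕ => hcon _ (hδ n) (min_le_left _ _)
  have ht : ∀ j ≤ k, Tendsto (fun n => ζ n j) atTop (𝓝 α) := fun j hj => by
    rw [tendsto_iff_norm_sub_tendsto_zero]
    exact squeeze_zero (fun _ => norm_nonneg _)
      (fun n => ((hζ n j hj).trans_le (min_le_right _ _)).le)
      tendsto_one_div_add_atTop_nhds_zero_nat
  have hs := tendsto_derivative_interpPoly hk hr hf ht
  have hg := (analyticAt_dslope hr hf).continuousAt.tendsto.comp (ht 0 (Nat.zero_le _))
  rw [dslope_same] at hg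
  have hq := ((hg.div hs hd).const_sub 1).norm
  rw [div_self hd, sub_self, norm_zero] at hq
  obtain ⟨n, h1, h2⟩ := ((hs.eventually_ne hd).and
    (hq.eventually (ge_mem_nhds (by norm_num : (0 : ℝ) < 1 / 2)))).exists
  refine (hbad n h1).not_ge ?_
  rw [step_sub_eq hα, norm_mul]
  gcongr
  exact h2

theorem IsGenSecantSeq.contraction {δ : ℝ} (hz : IsGenSecantSeq f k z)
    (hδ : ∀ ζ : ℕ → ℂ, (∀ j ≤ k, ‖ζ j - α‖ < δ) →
      (interpPoly f ζ k).derivative.eval (ζ 0) ≠ 0 ∧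
      ‖ζ 0 - f (ζ 0) / (interpPoly f ζ k).derivative.eval (ζ 0) - α‖ ≤ 1 / 2 * ‖ζ 0 - α‖)
    (h0 : ∀ i ≤ k, ‖z i - α‖ < δ) :
    (∀ n, ‖z n - α‖ < δ) ∧ (∀ n, k ≤ n → stepSlope f k z n ≠ 0) ∧ Tendsto z atTop (𝓝 α) := by
  have hstep : ∀ n, k ≤ n → (∀ j ≤ k, ‖z (n - j) - α‖ < δ) →
      stepSlope f k z n ≠ 0 ∧ ‖z (n + 1) - α‖ ≤ 1 / 2 * ‖z n - α‖ := by
    intro n hn h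
    rw [hz n hn]
    exact hδ (fun j => z (n - j)) h
  have hlt : ∀ n, ‖z n - α‖ < δ := by
    intro n
    induction n using Nat.strong_induction_on with
    | _ n ih =>
      rcases le_or_gt n k with hn | hn
      · exact h0 n hn
      · obtain ⟨m, rfl⟩ : ∃ m, n = m + 1 := ⟨n - 1, by omega⟩
        have h1 := (hstep m (by omega) fun j _ => ih _ (by omega)).2
        have h2 := ih m (by omega)
        linarith [norm_nonneg (z m - α)]
  refine ⟨hlt, fun n hn => (hstep n hn fun j _ => hlt _).1, ?_⟩
  rw [← tendsto_sub_nhds_zero_iff]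
  refine tendsto_zero_of_norm_succ_le (a := 1 / 2) (by norm_num) (by norm_num)
    (tendsto_const_nhds (x := (0 : ℝ))) ?_
  filter_upwards [eventually_ge_atTop k] with n hn
  rw [add_zero]
  exact (hstep n hn fun j _ => hlt _).2

theorem tendsto_comp_sub {z : ℕ → ℂ} {a : ℂ} (hz : Tendsto z atTop (𝓝 a)) (j : ℕ) :
    Tendsto (fun n => z (n - j)) atTop (𝓝 a) := hz.comp (tendsto_sub_atTop_nat j)

theorem tendsto_div_comp_sub {ε : ℕ → ℂ} (hne : ∀ᶠ n in atTop, ε n ≠ 0)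
    (h : Tendsto (fun n => ε (n + 1) / ε n) atTop (𝓝 0)) (j : ℕ) :
    Tendsto (fun n => ε n / ε (n - (j + 1))) atTop (𝓝 0) := by
  rw [← tendsto_add_atTop_iff_nat (j + 1)]
  simp only [Nat.add_sub_cancel]
  induction j with
  | zero => exact h
  | succ j ih =>
    have h1 := (h.comp (tendsto_add_atTop_nat (j + 1))).mul ih
    rw [mul_zero] at h1
    refine h1.congr' ?_
    filter_upwards [(tendsto_add_atTop_nat (j + 1)).eventually hne] with n hn
    exact div_mul_div_cancel₀ hn

/-- The errors satisfy `ε_{n+1} / ∏_{i ≤ k} ε_{n-i} → L`. -/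
theorem IsGenSecantSeq.tendsto_div_prod (hk : 1 ≤ k) (hr : 0 < r)
    (hf : DiffContOnCl ℂ f (Metric.ball α r)) (hα : f α = 0) (hd : deriv f α ≠ 0)
    (hz : IsGenSecantSeq f k z) (hzt : Tendsto z atTop (𝓝 α)) (hne : ∀ n, k ≤ n → z n ≠ α) :
    Tendsto (fun n => (z (n + 1) - α) / ∏ i ∈ Finset.range (k + 1), (z (n - i) - α))
      atTop (𝓝 (errConst f k α)) := by
  set ε : ℕ → ℂ := fun n => z n - α with hε
  set g := dslope f α
  set D : ℕ → ℂ := stepSlope f k z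
  set Q : ℕ → ℂ := fun n => dividedQuot f (fun i => z (n - i)) (k + 1) (z n)
  have hε0 : Tendsto ε atTop (𝓝 0) := by simpa using hzt.sub_const α
  have hεne : ∀ᶠ n in atTop, ε n ≠ 0 := by
    filter_upwards [eventually_ge_atTop k] with n hn using sub_ne_zero.2 (hne n hn)
  have hD : Tendsto D atTop (𝓝 (deriv f α)) :=
    tendsto_derivative_interpPoly hk hr hf (ζ := fun n i => z (n - i))
      fun j _ => tendsto_comp_sub hzt j
  have hQ : Tendsto Q atTop (𝓝 (iteratedDeriv (k + 1) f α / ((k + 1).factorial : ℂ))) :=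
    tendsto_dividedQuot hr hf (k + 1) (ζ := fun n i => z (n - i))
      (fun j _ => tendsto_comp_sub hzt j) hzt
  have hg : Tendsto (fun n => g (z n)) atTop (𝓝 (deriv f α)) := by
    have := (analyticAt_dslope hr hf).continuousAt.tendsto.comp hzt
    rwa [dslope_same] at this
  have hg' : Tendsto (fun n => deriv g (z n)) atTop (𝓝 (deriv g α)) :=
    (analyticAt_dslope hr hf).deriv.continuousAt.tendsto.comp hzt
  have hratio : Tendsto (fun n => ε (n + 1) / ε n) atTop (𝓝 0) := by
    have h1 := (hg.div hD hd).const_sub 1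
    rw [div_self hd, sub_self] at h1
    refine h1.congr' ?_
    filter_upwards [eventually_ge_atTop k] with n hn
    have h2 : ε (n + 1) = (1 - g (z n) / D n) * ε n := by
      rw [hε]; simp only
      rw [hz n hn, step_sub_eq hα]
    rw [h2, mul_div_cancel_right₀ _ (sub_ne_zero.2 (hne n hn)), Pi.div_apply]
  have hprod : Tendsto (fun n => ∏ j ∈ Finset.range k, (ε n / ε (n - (j + 1)) - 1)) atTop
      (𝓝 ((-1) ^ k)) := by
    have := tendsto_finsetProd (Finset.range k) fun j _ =>
      (tendsto_div_comp_sub hεne hratio j).sub_const 1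
    simpa using this
  -- The error identity at index n + 1 contains the square of ε (n + 1). Replacing one factor by t n
  -- times the preceding product of errors gives t (n + 1) = a (n + 1) * t n + b (n + 1). As a tends
  -- to 0, no prior bound on t is needed.
  set t : ℕ → ℂ := fun n => ε (n + 1) / ∏ i ∈ Finset.range (k + 1), ε (n - i)
  set a : ℕ → ℂ := fun n => deriv g (z n) * ε (n - (1 + k)) / D n
  set b : ℕ → ℂ := fun n => -(Q n * ∏ j ∈ Finset.range k, (ε n / ε (n - (j + 1)) - 1)) / D n
  have ha : Tendsto a atTop (𝓝 0) := by
    have := (hg'.mul (tendsto_comp_sub hε0 (1 + k))).div hD hd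
    rw [mul_zero, zero_div] at this
    exact this
  have hb : Tendsto b atTop (𝓝 (errConst f k α)) := by
    have h1 := (hQ.mul hprod).neg.div hD hd
    refine (h1.congr fun n => rfl).trans_eq ?_
    congr 1
    rw [errConst, pow_succ]
    field_simp
  have hrec : ∀ᶠ n in atTop, t (n + 1) = a (n + 1) * t n + b (n + 1) := by
    have hball : ∀ᶠ n in atTop, ∀ m, n ≤ m → z m ∈ Metric.ball α r :=
      eventually_forall_ge_atTop.2 (hzt (Metric.ball_mem_nhds α hr))
    have hDne : ∀ᶠ n in atTop, D (n + 1) ≠ 0 :=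
      (tendsto_add_atTop_nat 1).eventually (hD.eventually_ne hd)
    obtain ⟨N, hN⟩ := eventually_atTop.1 hball
    -- The threshold keeps all indices down to n - k beyond both k, where errors are nonzero, and N,
    -- where the points lie in the ball.
    filter_upwards [eventually_ge_atTop (N + 2 * k + 1), hDne] with n hn hDn
    have hε' : ∀ i ≤ k + 1, ε (n + 1 - i) ≠ 0 := fun i hi => sub_ne_zero.2 (hne _ (by omega))
    have hDn' : D (n + 1) = deriv f (z (n + 1)) -
        Q (n + 1) * ∏ j ∈ Finset.range k, (z (n + 1) - z (n + 1 - (j + 1))) :=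
      derivative_interpPoly_eval_of_mem_ball hf (ζ := fun i => z (n + 1 - i))
        fun j hj => hN N le_rfl _ (by omega)
    rw [deriv_eq_dslope_add hr hf hα (hN N le_rfl _ (by omega))] at hDn'
    set R := ∏ j ∈ Finset.range k, ε (n + 1 - (j + 1)) with hR
    have hR0 : R ≠ 0 := Finset.prod_ne_zero_iff.2 fun j hj =>
      hε' _ (by have := Finset.mem_range.1 hj; omega)
    have hP1 : ∏ j ∈ Finset.range k, (z (n + 1) - z (n + 1 - (j + 1))) =
        R * ∏ j ∈ Finset.range k, (ε (n + 1) / ε (n + 1 - (j + 1)) - 1) := by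
      rw [hR, ← Finset.prod_mul_distrib]
      refine Finset.prod_congr rfl fun j hj => ?_
      rw [mul_sub, mul_div_cancel₀ _ (hε' _ (by have := Finset.mem_range.1 hj; omega))]
      simp only [hε]; ring
    have hP2 : ∏ i ∈ Finset.range (k + 1), ε (n + 1 - i) = R * ε (n + 1) := by
      rw [Finset.prod_range_succ']; rfl
    have hP3 : ∏ i ∈ Finset.range (k + 1), ε (n - i) = R * ε (n + 1 - (1 + k)) := by
      rw [Finset.prod_range_succ, hR]
      congr 1
      · exact Finset.prod_congr rfl fun j _ => by rw [Nat.add_sub_add_right]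
      · congr 1; omega
    have hs : ε (n + 1 + 1) * D (n + 1) = ε (n + 1) * D (n + 1) - ε (n + 1) * g (z (n + 1)) := by
      have : ε (n + 1 + 1) = (1 - g (z (n + 1)) / D (n + 1)) * ε (n + 1) := by
        simp only [hε]
        rw [hz (n + 1) (by omega), step_sub_eq hα]
      rw [this]; field_simp
    have hε1 : ε (n + 1) ≠ 0 := hε' 0 (by omega)
    have hεk : ε (n + 1 - (1 + k)) ≠ 0 := hε' _ (by omega)
    have hat : a (n + 1) * t n = deriv g (z (n + 1)) * ε (n + 1) / (R * D (n + 1)) := by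
      simp only [a, t]
      rw [hP3]; field_simp
    rw [hat]
    simp only [t, b]
    rw [hP2]
    rw [hP1] at hDn'
    set W := ∏ j ∈ Finset.range k, (ε (n + 1) / ε (n + 1 - (j + 1)) - 1)
    have hzε : z (n + 1) - α = ε (n + 1) := rfl
    rw [hzε] at hDn'
    field_simp
    rw [hs]
    linear_combination ε (n + 1) * hDn'
  rw [← tendsto_sub_nhds_zero_iff]
  have ha1 := ha.comp (tendsto_add_atTop_nat 1)
  have hb1 := hb.comp (tendsto_add_atTop_nat 1)
  have he : Tendsto (fun n => ‖a (n + 1) * errConst f k α + (b (n + 1) - errConst f k α)‖) atTop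
      (𝓝 0) := by
    have := ((ha1.mul_const (errConst f k α)).add (hb1.sub_const (errConst f k α))).norm
    simpa using this
  refine tendsto_zero_of_norm_succ_le (y := fun n => t n - errConst f k α)
    (a := 1 / 2) (by norm_num) (by norm_num) he ?_
  have hahalf : ∀ᶠ n in atTop, ‖a (n + 1)‖ ≤ 1 / 2 := by
    have := ha1.norm
    rw [norm_zero] at this
    exact this.eventually (ge_mem_nhds (by norm_num))
  filter_upwards [hrec, hahalf] with n h1 h2
  rw [h1]
  calc _ = ‖a (n + 1) * (t n - errConst f k α) +
        (a (n + 1) * errConst f k α + (b (n + 1) - errConst f k α))‖ := by congr 1; ring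
    _ ≤ _ := by
      refine (norm_add_le _ _).trans ?_
      rw [norm_mul]
      gcongr

/-! ### Newton's method -/

/-- With g = `dslope f α`, the numerator f' - g of the error multiplier equals (w - α) g', which
supplies the second factor w - α. -/
theorem newton_error (hr : 0 < r) (hf : DiffContOnCl ℂ f (Metric.ball α r)) (hα : f α = 0)
    {w : ℂ} (hw : w ∈ Metric.ball α r) (hw' : deriv f w ≠ 0) :
    w - f w / deriv f w - α = deriv (dslope f α) w / deriv f w * (w - α) ^ 2 := by
  rw [step_sub_eq hα]
  have h := deriv_eq_dslope_add hr hf hα hw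
  field_simp
  linear_combination (w - α) * h

theorem tendsto_newton_error (hr : 0 < r) (hf : DiffContOnCl ℂ f (Metric.ball α r)) (hα : f α = 0)
    (hd : deriv f α ≠ 0) (hz : ∀ n, k ≤ n → z (n + 1) = z n - f (z n) / deriv f (z n))
    (hzt : Tendsto z atTop (𝓝 α)) (hne : ∀ n, k ≤ n → z n ≠ α) :
    Tendsto (fun n => (z (n + 1) - α) / (z n - α) ^ 2) atTop
      (𝓝 (iteratedDeriv 2 f α / (2 * deriv f α))) := by
  have hdz := (tendsto_deriv hr hf).comp hzt
  have h1 := ((analyticAt_dslope hr hf).deriv.continuousAt.tendsto.comp hzt).div hdz hd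
  rw [deriv_dslope_self hr hf, div_div] at h1
  refine h1.congr' ?_
  filter_upwards [eventually_ge_atTop k, hzt (Metric.ball_mem_nhds α hr), hdz.eventually_ne hd]
    with n hn hb hdn
  rw [hz n hn, newton_error hr hf hα hb hdn,
    mul_div_cancel_right₀ _ (pow_ne_zero 2 (sub_ne_zero.2 (hne n hn)))]
  rfl

theorem newton_order_two (hr : 0 < r) (hf : DiffContOnCl ℂ f (Metric.ball α r)) (hα : f α = 0)
    (hd : deriv f α ≠ 0) (hz : ∀ n, k ≤ n → z (n + 1) = z n - f (z n) / deriv f (z n))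
    (hzt : Tendsto z atTop (𝓝 α)) (hne : ∀ n, k ≤ n → z n ≠ α) (h2 : iteratedDeriv 2 f α ≠ 0) :
    ConvergesWithOrder z α 2 := by
  refine ⟨hzt, ‖iteratedDeriv 2 f α / (2 * deriv f α)‖,
    norm_pos_iff.2 (div_ne_zero h2 (mul_ne_zero two_ne_zero hd)), ?_⟩
  refine (tendsto_newton_error hr hf hα hd hz hzt hne).norm.congr fun n => ?_
  rw [norm_div, norm_pow, Real.rpow_two]

/-- If g' = `deriv (dslope f α)` has a zero of order j at α, the Newton error is a nonvanishing
factor times (w - α)^(j+2). Here j ≥ 1 because g'(α) = f''(α)/2 = 0. -/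
theorem newton_order_gt_two (hr : 0 < r) (hf : DiffContOnCl ℂ f (Metric.ball α r)) (hα : f α = 0)
    (hd : deriv f α ≠ 0) (hz : ∀ n, k ≤ n → z (n + 1) = z n - f (z n) / deriv f (z n))
    (hzt : Tendsto z atTop (𝓝 α)) (hne : ∀ n, k ≤ n → z n ≠ α) (h2 : iteratedDeriv 2 f α = 0) :
    ∃ p : ℝ, 2 < p ∧ ConvergesWithOrder z α p := by
  have hdz := (tendsto_deriv hr hf).comp hzt
  have hA := (analyticAt_dslope hr hf).deriv
  have herr : ∀ᶠ n in atTop,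
      z (n + 1) - α = deriv (dslope f α) (z n) / deriv f (z n) * (z n - α) ^ 2 := by
    filter_upwards [eventually_ge_atTop k, hzt (Metric.ball_mem_nhds α hr), hdz.eventually_ne hd]
      with n hn hb hdn
    rw [hz n hn, newton_error hr hf hα hb hdn]
  -- If g' vanished near α, a Newton step would land exactly on α, which is excluded; so the order
  -- of vanishing is finite.
  have hnz : ¬ ∀ᶠ w in 𝓝 α, deriv (dslope f α) w = 0 := by
    intro h
    obtain ⟨n, h1, h3, hn⟩ := ((hzt.eventually h).and (herr.and (eventually_ge_atTop k))).exists
    rw [h1, zero_div, zero_mul, sub_eq_zero] at h3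
    exact hne (n + 1) (by omega) h3
  obtain ⟨j, h, hh, hhα, hj⟩ := hA.exists_eventuallyEq_pow_smul_nonzero_iff.2 hnz
  have hj0 : j ≠ 0 := by
    rintro rfl
    have := hj.self_of_nhds
    rw [deriv_dslope_self hr hf, h2] at this
    simp at this
    exact hhα this.symm
  refine ⟨((j + 2 : ℕ) : ℝ), by exact_mod_cast (by omega : 2 < j + 2), hzt,
    ‖h α / deriv f α‖, norm_pos_iff.2 (div_ne_zero hhα hd), ?_⟩
  refine ((hh.continuousAt.tendsto.comp hzt).div hdz hd).norm.congr' ?_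
  filter_upwards [eventually_ge_atTop k, herr, hzt.eventually hj] with n hn h1 h3
  have hn0 : z n - α ≠ 0 := sub_ne_zero.2 (hne n hn)
  rw [h1, h3, Real.rpow_natCast, ← norm_pow, ← norm_div]
  congr 1
  simp only [Pi.div_apply, Function.comp, smul_eq_mul]
  rw [pow_add]
  field_simp

theorem stepSlope_eq_deriv_of_polynomial (hf : DiffContOnCl ℂ f (Metric.ball α r))
    {P : Polynomial ℂ} (hP : P.natDegree ≤ k)
    (hfP : ∀ w ∈ Metric.closedBall α r, f w = P.eval w) (hz : ∀ n, z n ∈ Metric.ball α r) (n : ℕ) :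
    stepSlope f k z n = deriv f (z n) := by
  have h1 := derivative_interpPoly_eval_of_mem_ball (k := k) hf (ζ := fun i => z (n - i))
    fun j _ => hz _
  rw [dividedQuot_eq_zero_of_polynomial Metric.isOpen_ball hP
    (fun w hw => hfP w (Metric.ball_subset_closedBall hw)) (fun j _ => hz _) (hz _), zero_mul,
    sub_zero] at h1
  exact h1

end Iteration

end GenSecant


/-! ### The main theorem -/

theorem theorem2p1 :
    ∃ s : ℕ → ℝ,
      -- `s k` is the unique positive root of `x^(k+1) = ∑_{i ≤ k} x^i`
      (∀ k : ℕ, 1 ≤ k → ∀ x : ℝ,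
        (0 < x ∧ x ^ (k + 1) = ∑ i ∈ Finset.range (k + 1), x ^ i) ↔ x = s k) ∧
      (∀ k : ℕ, 1 ≤ k → 1 < s k ∧ s k < 2) ∧
      (∀ k : ℕ, 2 ≤ k →
        2 - Real.exp 1 / 2 ^ (k + 1) < s k ∧ s k < 2 - 1 / 2 ^ (k + 1)) ∧
      (∀ k : ℕ, 1 ≤ k → s k < s (k + 1)) ∧
      Tendsto s atTop (𝓝 2) ∧
      ∀ (k : ℕ) (f : ℂ → ℂ) (α : ℂ) (r : ℝ), 1 ≤ k → 0 < r →
        ContDiffOn ℂ ((k + 1 : ℕ) : WithTop ℕ∞) f (Metric.closedBall α r) →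
        f α = 0 → deriv f α ≠ 0 →
        ∃ δ : ℝ, 0 < δ ∧ ∀ z : ℕ → ℂ,
          (∀ i ≤ k, ∀ j ≤ k, z i = z j → i = j) →
          (∀ i ≤ k, z i ∈ Metric.closedBall α r ∧ ‖z i - α‖ < δ) →
          GenSecant.IsGenSecantSeq f k z →
          -- the iteration is well defined and converges
          (∀ n, z n ∈ Metric.closedBall α r) ∧
          (∀ n, k ≤ n → GenSecant.stepSlope f k z n ≠ 0) ∧
          Tendsto z atTop (𝓝 α) ∧
          -- part 1
          (iteratedDeriv (k + 1) f α ≠ 0 → (∀ n, k ≤ n → z n ≠ α) →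
            Tendsto (fun n => (z (n + 1) - α) / ∏ i ∈ Finset.range (k + 1), (z (n - i) - α))
              atTop (𝓝 (GenSecant.errConst f k α)) ∧
            GenSecant.ConvergesWithOrder z α (s k) ∧
            Tendsto (fun n => ‖z (n + 1) - α‖ / ‖z n - α‖ ^ s k) atTop
              (𝓝 (‖GenSecant.errConst f k α‖ ^ ((s k - 1) / (k : ℝ)))) ∧
            Tendsto (fun n => Real.log ‖(z (n + 1) - α) / (z n - α)‖ /
                Real.log ‖(z n - α) / (z (n - 1) - α)‖) atTop (𝓝 (s k))) ∧
          -- part 2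
          ((∃ P : Polynomial ℂ, P.natDegree ≤ k ∧
              ∀ w ∈ Metric.closedBall α r, f w = P.eval w) →
            (∀ n, k ≤ n → z (n + 1) = z n - f (z n) / deriv f (z n)) ∧
            ((∀ n, k ≤ n → z n ≠ α) →
              Tendsto (fun n => (z (n + 1) - α) / (z n - α) ^ 2) atTop
                (𝓝 (iteratedDeriv 2 f α / (2 * deriv f α))) ∧
              (iteratedDeriv 2 f α ≠ 0 → GenSecant.ConvergesWithOrder z α 2) ∧
              (iteratedDeriv 2 f α = 0 →
                ∃ p : ℝ, 2 < p ∧ GenSecant.ConvergesWithOrder z α p))) := by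
  refine ⟨GenSecant.order, fun k _ => GenSecant.eq_order_iff k,
    fun k hk => ⟨GenSecant.one_lt_order hk, GenSecant.order_lt_two k⟩,
    fun k hk => ⟨GenSecant.lt_order (by omega), GenSecant.order_lt k⟩,
    fun k _ => GenSecant.order_lt_order_succ k, GenSecant.tendsto_order, ?_⟩
  intro k f α r hk hr hfC hα hd
  -- Complex differentiability on the closed disc already gives holomorphy inside and continuity up
  -- to the circle, as Cauchy's formula requires.
  have hf : DiffContOnCl ℂ f (Metric.ball α r) := by
    refine DifferentiableOn.diffContOnCl ?_
    rw [closure_ball _ hr.ne']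
    exact hfC.differentiableOn (by simp)
  obtain ⟨δ, hδ, hδr, hcontr⟩ := GenSecant.exists_contraction_radius hk hr hf hα hd
  refine ⟨δ, hδ, fun z _ hz0 hz => ?_⟩
  obtain ⟨hlt, hslope, hzt⟩ := hz.contraction hcontr fun i hi => (hz0 i hi).2
  have hball : ∀ n, z n ∈ Metric.ball α r := fun n => by
    rw [mem_ball_iff_norm]; exact (hlt n).trans_le hδr
  refine ⟨fun n => Metric.ball_subset_closedBall (hball n), hslope, hzt, ?_, ?_⟩
  · intro hD hne
    have hL : GenSecant.errConst f k α ≠ 0 := by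
      unfold GenSecant.errConst
      exact mul_ne_zero (div_ne_zero (pow_ne_zero _ (by norm_num))
        (by exact_mod_cast (k + 1).factorial_ne_zero)) (div_ne_zero hD hd)
    have hprod := hz.tendsto_div_prod hk hr hf hα hd hzt hne
    have hε : ∀ᶠ n in atTop, z n - α ≠ 0 := by
      filter_upwards [eventually_ge_atTop k] with n hn using sub_ne_zero.2 (hne n hn)
    have horder := GenSecant.tendsto_norm_div_rpow_order (ε := fun n => z n - α) hk hL hε hprod
    exact ⟨hprod, ⟨hzt, _, Real.rpow_pos_of_pos (norm_pos_iff.2 hL) _, horder⟩, horder,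
      GenSecant.tendsto_log_ratio (ε := fun n => z n - α) hk hL hε
        (by simpa using hzt.sub_const α) hprod⟩
  · rintro ⟨P, hP, hfP⟩
    have hnewton : ∀ n, k ≤ n → z (n + 1) = z n - f (z n) / deriv f (z n) := fun n hn => by
      rw [hz n hn, GenSecant.stepSlope_eq_deriv_of_polynomial hf hP hfP hball]
    exact ⟨hnewton, fun hne => ⟨GenSecant.tendsto_newton_error hr hf hα hd hnewton hzt hne,
      GenSecant.newton_order_two hr hf hα hd hnewton hzt hne,
      GenSecant.newton_order_gt_two hr hf hα hd hnewton hzt hne⟩⟩
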